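/- Let $H$ be a finite graph with chromatic number $\chi(H)=r+1$. For every $\varepsilon>0$ there exist $\delta=\delta(H,\varepsilon)>0$ and $n_0=n_0(H,\varepsilon)\in\mathbb N$ such that the following holds for every integer $m$ with $2\le m\le r$. Let $G$ be a graph on $n\ge n_0$ vertices that does not contain $H$ as a (not necessarily induced) subgraph, and suppose that $$N(G,K_m)\ \ge\ N(T_r(n),K_m)-\delta n^m .$$ Then $G$ can be obtained, up to isomorphism, from $T_r(n)$ by adding and deleting a set of at most $\varepsilon n^2$ edges. Here $N(G,K_m)$ denotes the number of copies of the complete graph $K_m$ in $G$, that is, the number of subgraphs of $G$ isomorphic to $K_m$, and $T_r(n)$ is the Turán graph, that is, the complete $r$-partite graph on $n$ vertices whose part sizes differ by at most one. -/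

import Mathlib

universe u v

/-- `numCliques G m` is `N(G, K_m)`, the number of (unlabelled) copies of the complete graph `K_m`
in the finite graph `G`, i.e. the number of subgraphs of `G` isomorphic to `K_m`. -/
noncomputable def numCliques {V : Type v} [Fintype V] (G : SimpleGraph V) (m : ℕ) : ℕ :=
  G.copyCount (SimpleGraph.completeGraph (Fin m))

/-- `ObtainableByEdits T G k`: the graph `G` can be obtained, up to relabelling the vertices, from
the graph `T` by adding and deleting a set of at most `k` edges. That is, after some identification
`f` of the vertex sets, at most `k` pairs are an edge of exactly one of `T` and `G`. -/
def ObtainableByEdits {U : Type u} {V : Type v} (T : SimpleGraph U) (G : SimpleGraph V)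
    (k : ℝ) : Prop :=
  ∃ f : U ≃ V,
    (symmDiff (T.map f).edgeSet G.edgeSet).Finite ∧
    ((symmDiff (T.map f).edgeSet G.edgeSet).ncard : ℝ) ≤ k

/-!
Writing `x s` for the density of ordered `s`-cliques among all `s`-tuples of vertices, the proof
compares `G` with the Turán graph through the whole sequence `x`, and needs neither the regularity
lemma nor a removal lemma.

* As `H` is `(r+1)`-colourable, it is contained in every blow-up of `K_{r+1}` with large parts. By
  Erdős's theorem on dense relations (`exists_box`), an `H`-free graph on many vertices therefore
  has `x (r+1)` close to `0` (`exists_cliqueDensity_le_of_free`).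
* Double counting a clique `Q` together with a vertex adjacent to all but at most one entry of `Q`
  gives the Moon–Moser inequalities `(k+1) x_{k+1}² ≤ x_k (x_{k+1} + k x_{k+2})`. If `x (r+1) = 0`,
  they bound every ratio `x (s+1) / x s` by its value `1 - s / r` in the Turán graph, so a single
  value `x m`, `2 ≤ m ≤ r`, that is as large as in the Turán graph forces all of them to be
  (`eq_turanCliqueDensity`). By compactness, approximate hypotheses force `x` to be close to the
  Turán sequence (`exists_forall_moonMoserSeqs_mem`).
* The inequality is then almost tight for the `r`-cliques of `G`: on average, an `r`-clique `Q` has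
  few vertices that miss at least two of its entries. Sorting the other vertices by the entry of `Q`
  that they miss gives an `r`-partition, in which an edge inside a class extends `r - 1` entries of
  `Q` to an `(r+1)`-clique. As there are few of these, some `Q` yields a partition with few edges
  inside the classes (`eventually_exists_partition`).
* Since `x 2` is almost `1 - 1 / r`, the classes are almost balanced and almost all edges between
  them are present, so that few edits lead to the Turán graph (`obtainableByEdits_of_partition`).
-/

/-! ### Ordered cliques and their common neighbourhoods -/

section OrderedCliques

open Finset
open scoped Classical

variable {V : Type v} [Fintype V] (G : SimpleGraph V)

/-- The ordered `k`-cliques of `G`: the `k`-tuples of pairwise adjacent vertices. -/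
noncomputable def orderedCliques (k : ℕ) : Finset (Fin k → V) :=
  {f | ∀ i j, i ≠ j → G.Adj (f i) (f j)}

/-- The vertices adjacent to every entry of the tuple `f`. -/
noncomputable def commonNeighbors {k : ℕ} (f : Fin k → V) : Finset V :=
  {y | ∀ i, G.Adj y (f i)}

/-- The ordered pairs of adjacent vertices inside the common neighbourhood of `f`. -/
noncomputable def commonEdges {k : ℕ} (f : Fin k → V) : Finset (V × V) :=
  {e | G.Adj e.1 e.2 ∧ e.1 ∈ commonNeighbors G f ∧ e.2 ∈ commonNeighbors G f}

/-- The vertices that miss at least two entries of the tuple `f`, i.e. those that are in the common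
neighbourhood of no tuple got from `f` by removing one entry. -/
noncomputable def stragglers {k : ℕ} (f : Fin (k + 1) → V) : Finset V :=
  {y | ∀ i : Fin (k + 1), y ∉ commonNeighbors G (i.removeNth f)}

variable {G}

lemma mem_orderedCliques {k : ℕ} {f : Fin k → V} :
    f ∈ orderedCliques G k ↔ ∀ i j, i ≠ j → G.Adj (f i) (f j) := by
  simp [orderedCliques]

lemma mem_commonNeighbors {k : ℕ} {f : Fin k → V} {y : V} :
    y ∈ commonNeighbors G f ↔ ∀ i, G.Adj y (f i) := by
  simp [commonNeighbors]

lemma mem_orderedCliques_succ {k : ℕ} (i : Fin (k + 1)) {f : Fin (k + 1) → V} :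
    f ∈ orderedCliques G (k + 1) ↔
      i.removeNth f ∈ orderedCliques G k ∧ f i ∈ commonNeighbors G (i.removeNth f) := by
  rw [mem_orderedCliques, mem_orderedCliques, mem_commonNeighbors]
  constructor
  · intro h
    refine ⟨fun a b hab => h _ _ ?_, fun a => h _ _ (Fin.succAbove_ne i a).symm⟩
    exact fun hh => hab (Fin.succAbove_right_injective hh)
  · rintro ⟨h1, h2⟩ a b hab
    rcases Fin.eq_self_or_eq_succAbove i a with rfl | ⟨a, rfl⟩
    · rcases Fin.eq_self_or_eq_succAbove a b with rfl | ⟨b, rfl⟩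
      · exact absurd rfl hab
      · exact h2 b
    · rcases Fin.eq_self_or_eq_succAbove i b with rfl | ⟨b, rfl⟩
      · exact (h2 a).symm
      · exact h1 a b fun hh => hab (by rw [hh])

/-- Summing over ordered `(k+1)`-cliques is summing over ordered `k`-cliques and the ways to extend
them by a vertex in position `i`. -/
lemma sum_orderedCliques_succ {k : ℕ} (i : Fin (k + 1)) (F : (Fin k → V) → V → ℕ) :
    ∑ Q ∈ orderedCliques G (k + 1), F (i.removeNth Q) (Q i) =
      ∑ R ∈ orderedCliques G k, ∑ y ∈ commonNeighbors G R, F R y := by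
  rw [Finset.sum_sigma']
  refine Finset.sum_bij' (fun Q _ => ⟨i.removeNth Q, Q i⟩) (fun x _ => i.insertNth x.2 x.1)
    ?_ ?_ ?_ ?_ ?_
  · intro Q hQ
    exact Finset.mem_sigma.2 ((mem_orderedCliques_succ i).1 hQ)
  · rintro ⟨R, y⟩ h
    refine (mem_orderedCliques_succ i).2 ?_
    simpa using Finset.mem_sigma.1 h
  · intro Q _
    simp
  · rintro ⟨R, y⟩ _
    simp
  · intro Q _
    rfl

lemma card_orderedCliques_succ (k : ℕ) :
    #(orderedCliques G (k + 1)) = ∑ R ∈ orderedCliques G k, #(commonNeighbors G R) := by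
  have := sum_orderedCliques_succ (G := G) (0 : Fin (k + 1)) (fun _ _ => 1)
  simpa using this

lemma sum_card_commonNeighbors_removeNth {k : ℕ} (i : Fin (k + 1)) :
    ∑ Q ∈ orderedCliques G (k + 1), #(commonNeighbors G (i.removeNth Q)) =
      ∑ R ∈ orderedCliques G k, #(commonNeighbors G R) ^ 2 := by
  rw [sum_orderedCliques_succ i (fun R _ => #(commonNeighbors G R))]
  simp [sq]

lemma sum_card_commonEdges (k : ℕ) :
    ∑ R ∈ orderedCliques G k, #(commonEdges G R) = #(orderedCliques G (k + 2)) := by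
  rw [card_orderedCliques_succ]
  have h := sum_orderedCliques_succ (G := G) (0 : Fin (k + 1))
    (fun R y => #(commonNeighbors G ((0 : Fin (k + 1)).insertNth (α := fun _ => V) y R)))
  simp only [Fin.insertNth_self_removeNth] at h
  rw [h]
  refine Finset.sum_congr rfl fun R _ => ?_
  rw [← Finset.card_sigma]
  refine Finset.card_bij' (fun e _ => ⟨e.1, e.2⟩) (fun x _ => (x.1, x.2)) ?_ ?_ ?_ ?_
  · rintro ⟨a, b⟩ h
    simp only [commonEdges, mem_filter, mem_univ, true_and] at h
    refine Finset.mem_sigma.2 ⟨h.2.1, mem_commonNeighbors.2 fun i => ?_⟩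
    rcases Fin.eq_self_or_eq_succAbove 0 i with rfl | ⟨i, rfl⟩
    · simpa using h.1.symm
    · simpa using mem_commonNeighbors.1 h.2.2 i
  · rintro ⟨a, b⟩ h
    obtain ⟨ha, hb⟩ := Finset.mem_sigma.1 h
    simp only [mem_commonNeighbors] at hb
    simp only [commonEdges, mem_filter, mem_univ, true_and]
    refine ⟨(by simpa using hb 0 : G.Adj b a).symm, ha, mem_commonNeighbors.2 fun i => ?_⟩
    simpa using hb i.succ
  · intro _ _
    rfl
  · intro _ _
    rfl

/-- Every vertex is in the common neighbourhood of at most one of the tuples got from `Q` by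
removing an entry, unless it is adjacent to all of `Q`. -/
lemma sum_card_removeNth_add_card_stragglers_le {k : ℕ} (Q : Fin (k + 1) → V) :
    ∑ i : Fin (k + 1), #(commonNeighbors G (i.removeNth Q)) + #(stragglers G Q) ≤
      Fintype.card V + k * #(commonNeighbors G Q) := by
  have h1 : ∑ i : Fin (k + 1), #(commonNeighbors G (i.removeNth Q)) =
      ∑ y : V, #{i : Fin (k + 1) | y ∈ commonNeighbors G (i.removeNth Q)} := by
    simp only [Finset.card_filter]
    rw [Finset.sum_comm]
    simp
  have h2 : #(stragglers G Q) = ∑ y : V, if y ∈ stragglers G Q then 1 else 0 := by simp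
  have h3 : #(commonNeighbors G Q) = ∑ y : V, if y ∈ commonNeighbors G Q then 1 else 0 := by simp
  rw [h1, h2, h3, Finset.mul_sum, ← Finset.card_univ, Finset.card_eq_sum_ones,
    ← Finset.sum_add_distrib, ← Finset.sum_add_distrib]
  refine Finset.sum_le_sum fun y _ => ?_
  by_cases hs : y ∈ stragglers G Q
  · have h0 : #{i : Fin (k + 1) | y ∈ commonNeighbors G (i.removeNth Q)} = 0 := by
      rw [Finset.card_eq_zero, Finset.filter_eq_empty_iff]
      intro i _
      simp only [stragglers, mem_filter, mem_univ, true_and] at hs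
      exact hs i
    simp [h0, hs]
  · by_cases hc : y ∈ commonNeighbors G Q
    · have h0 : #{i : Fin (k + 1) | y ∈ commonNeighbors G (i.removeNth Q)} ≤ k + 1 :=
        (Finset.card_le_univ _).trans (by simp)
      simp only [hs, hc, if_true, if_false]
      omega
    · simp only [hs, hc, if_false]
      rw [mem_commonNeighbors] at hc
      push Not at hc
      obtain ⟨j, hj⟩ := hc
      have h0 : #{i : Fin (k + 1) | y ∈ commonNeighbors G (i.removeNth Q)} ≤ 1 := by
        rw [Finset.card_le_one_iff_subset_singleton]
        refine ⟨j, fun i hi => ?_⟩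
        simp only [mem_filter, mem_univ, true_and, mem_commonNeighbors] at hi
        rcases Fin.eq_self_or_eq_succAbove i j with rfl | ⟨a, rfl⟩
        · simp
        · exact absurd (hi a) hj
      omega

/-- The Moon–Moser inequality for ordered cliques, with the number of stragglers as an extra term
that measures how far it is from equality. -/
lemma moon_moser_stragglers (k : ℕ) :
    (k + 1) * #(orderedCliques G (k + 1)) ^ 2 +
        #(orderedCliques G k) * ∑ Q ∈ orderedCliques G (k + 1), #(stragglers G Q) ≤
      #(orderedCliques G k) * (Fintype.card V * #(orderedCliques G (k + 1)) +
        k * #(orderedCliques G (k + 2))) := by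
  have h1 : (k + 1) * ∑ R ∈ orderedCliques G k, #(commonNeighbors G R) ^ 2 +
      ∑ Q ∈ orderedCliques G (k + 1), #(stragglers G Q) ≤
      Fintype.card V * #(orderedCliques G (k + 1)) + k * #(orderedCliques G (k + 2)) := by
    have h := Finset.sum_le_sum fun Q (_ : Q ∈ orderedCliques G (k + 1)) =>
      sum_card_removeNth_add_card_stragglers_le (G := G) Q
    rw [Finset.sum_add_distrib, Finset.sum_add_distrib, Finset.sum_comm, ← Finset.mul_sum,
      ← card_orderedCliques_succ] at h
    simp only [sum_card_commonNeighbors_removeNth] at h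
    simpa [mul_comm] using h
  have h2 : #(orderedCliques G (k + 1)) ^ 2 ≤
      #(orderedCliques G k) * ∑ R ∈ orderedCliques G k, #(commonNeighbors G R) ^ 2 := by
    rw [card_orderedCliques_succ]
    exact sq_sum_le_card_mul_sum_sq
  calc _ ≤ (k + 1) * (#(orderedCliques G k) *
            ∑ R ∈ orderedCliques G k, #(commonNeighbors G R) ^ 2) +
        #(orderedCliques G k) * ∑ Q ∈ orderedCliques G (k + 1), #(stragglers G Q) := by gcongr
    _ = #(orderedCliques G k) * ((k + 1) * ∑ R ∈ orderedCliques G k, #(commonNeighbors G R) ^ 2 +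
        ∑ Q ∈ orderedCliques G (k + 1), #(stragglers G Q)) := by ring
    _ ≤ _ := by gcongr

lemma sum_sum_card_commonEdges_removeNth_le (k : ℕ) :
    ∑ Q ∈ orderedCliques G (k + 1), ∑ i : Fin (k + 1), #(commonEdges G (i.removeNth Q)) ≤
      (k + 1) * (Fintype.card V * #(orderedCliques G (k + 2))) := by
  rw [Finset.sum_comm]
  have h : ∀ i : Fin (k + 1), ∑ Q ∈ orderedCliques G (k + 1), #(commonEdges G (i.removeNth Q)) ≤
      Fintype.card V * #(orderedCliques G (k + 2)) := by
    intro i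
    rw [sum_orderedCliques_succ i (fun R _ => #(commonEdges G R)), ← sum_card_commonEdges,
      Finset.mul_sum]
    refine Finset.sum_le_sum fun R _ => ?_
    rw [Finset.sum_const, smul_eq_mul]
    gcongr
    exact Finset.card_le_univ _
  refine (Finset.sum_le_sum fun i _ => h i).trans ?_
  simp

/-! ### Partitions from cliques -/

/-- The ordered pairs of adjacent vertices that the colouring `p` puts into the same class. -/
noncomputable def innerPairs (G : SimpleGraph V) {r : ℕ} (p : V → Fin r) : Finset (V × V) :=
  {e | G.Adj e.1 e.2 ∧ p e.1 = p e.2}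

/-- An ordered clique `Q` induces a partition of the vertices, where the `i`-th class consists of
vertices adjacent to all entries of `Q` but the `i`-th; the stragglers are put anywhere. -/
lemma exists_card_innerPairs_le {k : ℕ} (Q : Fin (k + 1) → V) :
    ∃ p : V → Fin (k + 1), #(innerPairs G p) ≤
      2 * (Fintype.card V * #(stragglers G Q)) +
        ∑ i : Fin (k + 1), #(commonEdges G (i.removeNth Q)) := by
  have h : ∀ y, ∃ i : Fin (k + 1), y ∉ stragglers G Q → y ∈ commonNeighbors G (i.removeNth Q) := by
    intro y
    by_cases hy : y ∈ stragglers G Q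
    · exact ⟨0, fun h => absurd hy h⟩
    · have := hy
      simp only [stragglers, mem_filter, mem_univ, true_and] at this
      push Not at this
      obtain ⟨i, hi⟩ := this
      exact ⟨i, fun _ => hi⟩
  choose p hp using h
  refine ⟨p, ?_⟩
  have hsub : innerPairs G p ⊆ (univ ×ˢ stragglers G Q ∪ stragglers G Q ×ˢ univ) ∪
      univ.biUnion fun i : Fin (k + 1) => commonEdges G (i.removeNth Q) := by
    rintro ⟨a, b⟩ hab
    simp only [innerPairs, mem_filter, mem_univ, true_and] at hab
    by_cases ha : a ∈ stragglers G Q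
    · simp [ha]
    by_cases hb : b ∈ stragglers G Q
    · simp [hb]
    refine Finset.mem_union_right _ (Finset.mem_biUnion.2 ⟨p a, mem_univ _, ?_⟩)
    simp only [commonEdges, mem_filter, mem_univ, true_and]
    exact ⟨hab.1, hp a ha, hab.2 ▸ hp b hb⟩
  refine (Finset.card_le_card hsub).trans <| (Finset.card_union_le _ _).trans ?_
  refine add_le_add ((Finset.card_union_le _ _).trans ?_) Finset.card_biUnion_le
  simp only [Finset.card_product, Finset.card_univ]
  exact le_of_eq (by ring)

/-- Averaging over ordered `(k+1)`-cliques: some clique induces a partition that is at most as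
costly as the average. -/
lemma exists_partition_of_average {k : ℕ} (hk : (orderedCliques G (k + 1)).Nonempty) {η : ℝ}
    (h : 2 * (Fintype.card V : ℝ) * (∑ Q ∈ orderedCliques G (k + 1), #(stragglers G Q) : ℕ) +
      (k + 1) * (Fintype.card V * #(orderedCliques G (k + 2))) ≤
        #(orderedCliques G (k + 1)) * η) :
    ∃ p : V → Fin (k + 1), (#(innerPairs G p) : ℝ) ≤ η := by
  have hsum : ∑ Q ∈ orderedCliques G (k + 1), ((2 * (Fintype.card V * #(stragglers G Q)) +
        ∑ i : Fin (k + 1), #(commonEdges G (i.removeNth Q)) : ℕ) : ℝ) ≤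
      ∑ _Q ∈ orderedCliques G (k + 1), η := by
    rw [Finset.sum_const, nsmul_eq_mul]
    refine le_trans ?_ h
    have h2 : ((∑ Q ∈ orderedCliques G (k + 1), ∑ i : Fin (k + 1),
        #(commonEdges G (i.removeNth Q)) : ℕ) : ℝ) ≤
        (k + 1) * (Fintype.card V * #(orderedCliques G (k + 2))) := by
      exact_mod_cast sum_sum_card_commonEdges_removeNth_le k
    push_cast at h2 ⊢
    rw [Finset.sum_add_distrib, ← Finset.mul_sum, ← Finset.mul_sum, ← mul_assoc]
    gcongr
  obtain ⟨Q, -, hQ⟩ := Finset.exists_le_of_sum_le hk hsum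
  obtain ⟨p, hp⟩ := exists_card_innerPairs_le (G := G) Q
  exact ⟨p, le_trans (by exact_mod_cast hp) hQ⟩

end OrderedCliques

/-! ### Rigidity and stability of the Moon–Moser inequalities -/

section MoonMoser

open Filter Topology

/-- `turanCliqueDensity r s` is the limiting density of ordered `s`-cliques in the Turán graphs with `r`
parts, i.e. the probability that `s` random vertices lie in different parts. -/
noncomputable def turanCliqueDensity (r s : ℕ) : ℝ := r.descFactorial s / (r : ℝ) ^ s

/-- The sequences that satisfy the Moon–Moser inequalities, together with the trivial constraints on
the densities of ordered cliques in a graph. -/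
def moonMoserSeqs : Set (ℕ → ℝ) :=
  {x | x 0 = 1 ∧ x 1 = 1 ∧ (∀ s, 0 ≤ x s) ∧ (∀ s, x (s + 1) ≤ x s) ∧
    ∀ k : ℕ, (k + 1) * x (k + 1) ^ 2 ≤ x k * (x (k + 1) + k * x (k + 2))}

variable {r : ℕ}

lemma turanCliqueDensity_zero : turanCliqueDensity r 0 = 1 := by simp [turanCliqueDensity]

lemma turanCliqueDensity_one (hr : 0 < r) : turanCliqueDensity r 1 = 1 := by
  have : (r : ℝ) ≠ 0 := by positivity
  simp [turanCliqueDensity, this]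

lemma turanCliqueDensity_succ (hr : 0 < r) (s : ℕ) :
    r * turanCliqueDensity r (s + 1) = (r - s) * turanCliqueDensity r s := by
  have h0 : (r : ℝ) ≠ 0 := by positivity
  unfold turanCliqueDensity
  rcases le_or_gt s r with h | h
  · rw [Nat.descFactorial_succ]
    push_cast [Nat.cast_sub h]
    field_simp
    ring
  · rw [Nat.descFactorial_of_lt h, Nat.descFactorial_of_lt (by omega : r < s + 1)]
    simp

lemma turanCliqueDensity_pos {s : ℕ} (hr : 0 < r) (hs : s ≤ r) : 0 < turanCliqueDensity r s := by
  have : 0 < r.descFactorial s :=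
    Nat.pos_of_ne_zero (by rw [Ne, Nat.descFactorial_eq_zero_iff_lt]; omega)
  unfold turanCliqueDensity
  positivity

lemma turanCliqueDensity_eq_zero {s : ℕ} (hs : r < s) : turanCliqueDensity r s = 0 := by
  simp [turanCliqueDensity, Nat.descFactorial_of_lt hs]

lemma isCompact_moonMoserSeqs : IsCompact moonMoserSeqs := by
  have hc : IsCompact (Set.univ.pi fun _ : ℕ => Set.Icc (0 : ℝ) 1) :=
    isCompact_univ_pi fun _ => isCompact_Icc
  refine hc.of_isClosed_subset ?_ ?_
  · simp only [moonMoserSeqs, Set.ofPred_and, Set.ofPred_forall]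
    refine (isClosed_eq (by fun_prop) (by fun_prop)).inter <|
      (isClosed_eq (by fun_prop) (by fun_prop)).inter <|
      (isClosed_iInter fun s => isClosed_le (by fun_prop) (by fun_prop)).inter <|
      (isClosed_iInter fun s => isClosed_le (by fun_prop) (by fun_prop)).inter <|
      isClosed_iInter fun s => isClosed_le (by fun_prop) (by fun_prop)
  · rintro x ⟨h0, -, hn, ha, -⟩ s -
    refine ⟨hn s, ?_⟩
    rw [← h0]
    exact antitone_nat_of_succ_le ha (Nat.zero_le s)

/-- If there are no `(r+1)`-cliques, then the Moon–Moser inequalities bound all ratios of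
consecutive clique densities by those of the Turán graph. -/
lemma mul_succ_le_of_moonMoser {x : ℕ → ℝ} (hx : x ∈ moonMoserSeqs) (h0 : x (r + 1) ≤ 0) {s : ℕ}
    (hs : s ≤ r) : r * x (s + 1) ≤ (r - s) * x s := by
  obtain ⟨-, -, hn, -, hm⟩ := hx
  induction hs using Nat.decreasingInduction with
  | self => nlinarith [hn r, Nat.cast_nonneg (α := ℝ) r]
  | of_succ k hk ih =>
    rcases (hn (k + 1)).eq_or_lt with h | h
    · rw [← h, mul_zero]
      have : (k : ℝ) + 1 ≤ r := by exact_mod_cast hk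
      exact mul_nonneg (by linarith) (hn k)
    · push_cast at ih
      have h1 : (k * x k) * (r * x (k + 2)) ≤ (k * x k) * ((r - (k + 1)) * x (k + 1)) :=
        mul_le_mul_of_nonneg_left ih (mul_nonneg k.cast_nonneg (hn k))
      have h2 := mul_le_mul_of_nonneg_left (hm k) (Nat.cast_nonneg (α := ℝ) r)
      have h3 : 0 < ((k : ℝ) + 1) * x (k + 1) := by positivity
      refine le_of_mul_le_mul_left ?_ h3
      linear_combination h1 + h2

/-- Rigidity: a Moon–Moser sequence that vanishes at `r + 1` and is at some `2 ≤ m ≤ r` at least as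
large as that of the Turán graph is that of the Turán graph. -/
lemma eq_turanCliqueDensity {x : ℕ → ℝ} (hx : x ∈ moonMoserSeqs) (h0 : x (r + 1) ≤ 0) {m : ℕ}
    (hm : 2 ≤ m) (hmr : m ≤ r) (hxm : turanCliqueDensity r m ≤ x m) : x = turanCliqueDensity r := by
  have hr : 0 < r := by omega
  have hr' : (0 : ℝ) < r := by positivity
  have hup := fun {s} hs => mul_succ_le_of_moonMoser (r := r) hx h0 (s := s) hs
  obtain ⟨hx0, hx1, hn, ha, hMM⟩ := hx
  -- The upper bounds on the ratios beyond `2` leave no room for a smaller value at `2`.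
  have h2 : x 2 = turanCliqueDensity r 2 := by
    have t2 := turanCliqueDensity_succ hr 1
    rw [turanCliqueDensity_one hr] at t2
    refine le_antisymm ?_ ?_
    · have := hup (s := 1) (by omega)
      rw [hx1] at this
      exact le_of_mul_le_mul_left (this.trans_eq t2.symm) hr'
    · have key : ∀ s, 2 ≤ s → s ≤ m →
          x s * turanCliqueDensity r 2 ≤ turanCliqueDensity r s * x 2 := by
        intro s hs
        induction s, hs using Nat.le_induction with
        | base => intro _; rw [mul_comm]
        | succ s hs ih =>
          intro hsm
          have hsr : (s : ℝ) ≤ r := by exact_mod_cast (by omega : s ≤ r)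
          have i1 := mul_le_mul_of_nonneg_left (ih (by omega)) (sub_nonneg.2 hsr)
          have i2 := mul_le_mul_of_nonneg_right (hup (s := s) (by omega))
            (turanCliqueDensity_pos hr (by omega : 2 ≤ r)).le
          refine le_of_mul_le_mul_left ?_ hr'
          have i3 := turanCliqueDensity_succ hr s
          linear_combination i1 + i2 - x 2 * i3
      have hk := key m hm le_rfl
      have hpos := turanCliqueDensity_pos hr hmr
      have hpos2 := turanCliqueDensity_pos hr (by omega : 2 ≤ r)
      refine le_of_mul_le_mul_left ?_ hpos
      exact (mul_le_mul_of_nonneg_right hxm hpos2.le).trans hk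
  -- From tight values at `s + 1` and `s + 2`, the Moon–Moser inequality bounds the next from below.
  have step : ∀ s, s + 2 ≤ r →
      x (s + 1) = turanCliqueDensity r (s + 1) ∧ x (s + 2) = turanCliqueDensity r (s + 2) := by
    intro s
    induction s with
    | zero => exact fun _ => ⟨by rw [hx1, turanCliqueDensity_one hr], h2⟩
    | succ s ih =>
      intro hs
      obtain ⟨e1, e2⟩ := ih (by omega)
      refine ⟨e2, le_antisymm ?_ ?_⟩
      · have := hup (s := s + 2) (by omega)
        rw [e2, ← turanCliqueDensity_succ hr (s + 2)] at this
        exact le_of_mul_le_mul_left this hr'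
      · have h := hMM (s + 1)
        have p1 := turanCliqueDensity_pos hr (by omega : s + 1 ≤ r)
        have t1 := turanCliqueDensity_succ hr (s + 1)
        have t2 := turanCliqueDensity_succ hr (s + 2)
        rw [e1, e2] at h
        push_cast at h t1 t2
        set A := turanCliqueDensity r (s + 1)
        set B := turanCliqueDensity r (s + 1 + 1)
        set C := turanCliqueDensity r (s + 2 + 1)
        have h3 : 0 < ((s : ℝ) + 1) * A * r := by positivity
        refine le_of_mul_le_mul_left ?_ h3
        change _ ≤ _ * x (s + 1 + 2)
        change r * B = _ at t1
        change r * C = _ * B at t2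
        have h' := mul_le_mul_of_nonneg_left h hr'.le
        linear_combination h' + (s + 1) * A * t2 - (s + 2) * B * t1
  funext s
  rcases lt_or_ge r s with h | h
  · rw [turanCliqueDensity_eq_zero h]
    exact le_antisymm ((antitone_nat_of_succ_le ha (by omega : r + 1 ≤ s)).trans h0) (hn s)
  · match s with
    | 0 => rw [hx0, turanCliqueDensity_zero]
    | 1 => rw [hx1, turanCliqueDensity_one hr]
    | s + 2 => exact (step s h).2

/-- Stability: by compactness, the rigidity of the Moon–Moser inequalities is robust. -/
lemma exists_forall_moonMoserSeqs_mem (r : ℕ) {U : Set (ℕ → ℝ)} (hU : U ∈ 𝓝 (turanCliqueDensity r)) :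
    ∃ δ > 0, ∀ m, 2 ≤ m → m ≤ r → ∀ x ∈ moonMoserSeqs, x (r + 1) ≤ δ →
      turanCliqueDensity r m - δ ≤ x m → x ∈ U := by
  have key : ∀ m ∈ Finset.Icc 2 r, ∀ᶠ δ : ℝ in 𝓝[>] 0, ∀ x ∈ moonMoserSeqs, x (r + 1) ≤ δ →
      turanCliqueDensity r m - δ ≤ x m → x ∈ U := by
    intro m hm
    obtain ⟨hm2, hmr⟩ := Finset.mem_Icc.1 hm
    have hK : IsCompact (moonMoserSeqs \ interior U) :=
      isCompact_moonMoserSeqs.diff isOpen_interior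
    have hmem : ∀ x ∈ moonMoserSeqs, x ∉ moonMoserSeqs \ interior U → x ∈ U := by
      intro x hx h
      by_contra hxU
      exact h ⟨hx, fun h' => hxU (interior_subset h')⟩
    rcases (moonMoserSeqs \ interior U).eq_empty_or_nonempty with he | hne
    · exact Eventually.of_forall fun δ x hx _ _ => hmem x hx (by simp [he])
    -- This function measures the failure of the hypotheses; by rigidity it is positive off `U`.
    have hf : Continuous fun x : ℕ → ℝ => max (x (r + 1)) (turanCliqueDensity r m - x m) := by
      fun_prop
    obtain ⟨z, ⟨hz, hzU⟩, hmin⟩ := hK.exists_isMinOn hne hf.continuousOn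
    have hpos : 0 < max (z (r + 1)) (turanCliqueDensity r m - z m) := by
      by_contra hcon
      rw [not_lt, max_le_iff] at hcon
      refine hzU ?_
      rw [eq_turanCliqueDensity hz hcon.1 hm2 hmr (by linarith [hcon.2])]
      exact mem_interior_iff_mem_nhds.2 hU
    filter_upwards [Ioo_mem_nhdsGT hpos] with δ hδ x hx h1 h2
    refine hmem x hx fun hxU => ?_
    have := isMinOn_iff.1 hmin x hxU
    exact absurd (this.trans (max_le h1 (by linarith))) (not_le.2 hδ.2)
  have hall := (Filter.eventually_all_finset (Finset.Icc 2 r)).2 key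
  obtain ⟨δ, h1, h2⟩ := (hall.and self_mem_nhdsWithin).exists
  exact ⟨δ, h2, fun m hm hmr => h1 m (Finset.mem_Icc.2 ⟨hm, hmr⟩)⟩

end MoonMoser

/-! ### Clique densities of graphs -/

section CliqueDensity

open Finset Filter Topology
open scoped Classical

variable {V : Type v} [Fintype V] (G : SimpleGraph V)

/-- The density of ordered `s`-cliques among all `s`-tuples of vertices. -/
noncomputable def cliqueDensity (s : ℕ) : ℝ := #(orderedCliques G s) / (Fintype.card V : ℝ) ^ s

variable {G}

lemma card_orderedCliques_succ_le (s : ℕ) :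
    #(orderedCliques G (s + 1)) ≤ Fintype.card V * #(orderedCliques G s) := by
  rw [card_orderedCliques_succ, mul_comm, ← smul_eq_mul, ← Finset.sum_const]
  exact Finset.sum_le_sum fun R _ => Finset.card_le_univ _

lemma card_orderedCliques_eq [Nonempty V] (s : ℕ) :
    (#(orderedCliques G s) : ℝ) = cliqueDensity G s * (Fintype.card V : ℝ) ^ s := by
  have : (0 : ℝ) < Fintype.card V := by exact_mod_cast Fintype.card_pos
  unfold cliqueDensity
  field_simp

lemma cliqueDensity_mem_moonMoserSeqs [Nonempty V] : cliqueDensity G ∈ moonMoserSeqs := by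
  have hn : (0 : ℝ) < Fintype.card V := by exact_mod_cast Fintype.card_pos
  refine ⟨?_, ?_, ?_, ?_, ?_⟩
  · simp [cliqueDensity, orderedCliques]
  · have : orderedCliques G 1 = univ := by
      ext f
      simp only [mem_orderedCliques, mem_univ, iff_true]
      exact fun i j hij => absurd (Subsingleton.elim i j) hij
    simp [cliqueDensity, this, hn.ne']
  · intro s
    unfold cliqueDensity
    positivity
  · intro s
    have h : (#(orderedCliques G (s + 1)) : ℝ) ≤ Fintype.card V * #(orderedCliques G s) := by
      exact_mod_cast card_orderedCliques_succ_le s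
    rw [card_orderedCliques_eq, card_orderedCliques_eq] at h
    have h3 : (0 : ℝ) < (Fintype.card V : ℝ) ^ (s + 1) := by positivity
    refine le_of_mul_le_mul_right ?_ h3
    linear_combination h
  · intro k
    have h : ((k : ℝ) + 1) * (#(orderedCliques G (k + 1)) : ℝ) ^ 2 ≤ #(orderedCliques G k) *
        (Fintype.card V * #(orderedCliques G (k + 1)) + k * #(orderedCliques G (k + 2))) := by
      exact_mod_cast (Nat.le_add_right _ _).trans (moon_moser_stragglers (G := G) k)
    simp only [card_orderedCliques_eq] at h
    have h3 : (0 : ℝ) < (Fintype.card V : ℝ) ^ (2 * k + 2) := by positivity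
    refine le_of_mul_le_mul_right ?_ h3
    linear_combination h

/-- If the Moon–Moser inequality is almost tight at `k` and there are few `(k+2)`-cliques, then `G`
is almost `(k+1)`-partite. -/
lemma exists_partition_of_cliqueDensity [Nonempty V] {k : ℕ} {η : ℝ}
    (h0 : 0 < cliqueDensity G k) (h1 : 0 < cliqueDensity G (k + 1))
    (h : 2 * (cliqueDensity G k * (cliqueDensity G (k + 1) + k * cliqueDensity G (k + 2)) -
          (k + 1) * cliqueDensity G (k + 1) ^ 2) +
        (k + 1) * cliqueDensity G (k + 2) * cliqueDensity G k ≤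
      η * (cliqueDensity G k * cliqueDensity G (k + 1))) :
    ∃ p : V → Fin (k + 1), (#(innerPairs G p) : ℝ) ≤ η * (Fintype.card V : ℝ) ^ 2 := by
  have hn : (0 : ℝ) < Fintype.card V := by exact_mod_cast Fintype.card_pos
  have hne : (orderedCliques G (k + 1)).Nonempty := by
    rw [← Finset.card_pos, ← Nat.cast_pos (α := ℝ), card_orderedCliques_eq]
    positivity
  refine exists_partition_of_average hne ?_
  have hmm : ((k : ℝ) + 1) * (#(orderedCliques G (k + 1)) : ℝ) ^ 2 + #(orderedCliques G k) *
      (∑ Q ∈ orderedCliques G (k + 1), #(stragglers G Q) : ℕ) ≤ #(orderedCliques G k) *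
        (Fintype.card V * #(orderedCliques G (k + 1)) + k * #(orderedCliques G (k + 2))) := by
    exact_mod_cast moon_moser_stragglers (G := G) k
  simp only [card_orderedCliques_eq] at hmm ⊢
  set S : ℝ := ((∑ Q ∈ orderedCliques G (k + 1), #(stragglers G Q) : ℕ) : ℝ)
  set n : ℝ := (Fintype.card V : ℝ)
  have h3 : (0 : ℝ) < cliqueDensity G k * n ^ k := by positivity
  refine le_of_mul_le_mul_left ?_ h3
  have h4 := mul_le_mul_of_nonneg_left hmm (by positivity : 0 ≤ 2 * n)
  have h5 := mul_le_mul_of_nonneg_left h (by positivity : 0 ≤ n ^ (2 * k + 3))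
  linear_combination h4 + h5

/-- If the clique densities of `G` are close to those of the Turán graph with `r` parts, then
`G` is almost `r`-partite and has almost the density of the Turán graph. -/
lemma eventually_exists_partition {r : ℕ} (hr : 2 ≤ r) {η : ℝ} (hη : 0 < η) :
    ∀ᶠ x in 𝓝 (turanCliqueDensity r), ∀ (V : Type v) [Fintype V] [Nonempty V] (G : SimpleGraph V),
      cliqueDensity G = x → (1 - 1 / r - η) ≤ cliqueDensity G 2 ∧
        ∃ p : V → Fin r, (#(innerPairs G p) : ℝ) ≤ η * (Fintype.card V : ℝ) ^ 2 := by
  obtain ⟨k, rfl⟩ : ∃ k, r = k + 1 := ⟨r - 1, by omega⟩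
  have hr0 : 0 < k + 1 := by omega
  have p0 := turanCliqueDensity_pos hr0 (by omega : k ≤ k + 1)
  have p1 := turanCliqueDensity_pos hr0 le_rfl
  have t1 := turanCliqueDensity_succ hr0 k
  have t2 := turanCliqueDensity_eq_zero (by omega : k + 1 < k + 2)
  have t3 := turanCliqueDensity_succ hr0 1
  rw [turanCliqueDensity_one hr0] at t3
  have hc : ∀ s : ℕ, Continuous fun x : ℕ → ℝ => x s := fun s => continuous_apply s
  have e0 : ∀ᶠ x in 𝓝 (turanCliqueDensity (k + 1)), 0 < x k :=
    (hc k).continuousAt.eventually_const_lt p0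
  have e1 : ∀ᶠ x in 𝓝 (turanCliqueDensity (k + 1)), 0 < x (k + 1) :=
    (hc (k + 1)).continuousAt.eventually_const_lt p1
  have e2 : ∀ᶠ x in 𝓝 (turanCliqueDensity (k + 1)), 1 - 1 / ((k + 1 : ℕ) : ℝ) - η < x 2 := by
    refine (hc 2).continuousAt.eventually_const_lt ?_
    have : turanCliqueDensity (k + 1) 2 = 1 - 1 / ((k + 1 : ℕ) : ℝ) := by
      have : ((k + 1 : ℕ) : ℝ) ≠ 0 := by positivity
      field_simp
      push_cast at t3 ⊢
      linear_combination t3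
    linarith [show (fun x : ℕ → ℝ => x 2) (turanCliqueDensity (k + 1)) = _ from this]
  have e3 : ∀ᶠ x in 𝓝 (turanCliqueDensity (k + 1)),
      2 * (x k * (x (k + 1) + k * x (k + 2)) - (k + 1) * x (k + 1) ^ 2) +
        (k + 1) * x (k + 2) * x k < η * (x k * x (k + 1)) := by
    have c1 : Continuous fun x : ℕ → ℝ =>
      2 * (x k * (x (k + 1) + k * x (k + 2)) - (k + 1) * x (k + 1) ^ 2) +
        (k + 1) * x (k + 2) * x k := by fun_prop
    have c2 : Continuous fun x : ℕ → ℝ => η * (x k * x (k + 1)) := by fun_prop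
    refine c1.continuousAt.eventually_lt c2.continuousAt ?_
    have h : 0 < η * (turanCliqueDensity (k + 1) k * turanCliqueDensity (k + 1) (k + 1)) := by
      positivity
    refine lt_of_eq_of_lt ?_ h
    rw [t2]
    push_cast at t1
    linear_combination -2 * turanCliqueDensity (k + 1) (k + 1) * t1
  filter_upwards [e0, e1, e2, e3] with x h0 h1 h2 h3 V _ _ G hG
  subst hG
  exact ⟨h2.le, exists_partition_of_cliqueDensity h0 h1 h3.le⟩

end CliqueDensity

/-! ### From an almost partite graph to the Turán graph -/

section Edits

open Finset
open scoped Classical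

/-- A bijection that respects two colourings as well as possible: the colour `i` is missed only as
often as it is more frequent on the right than on the left. -/
lemma exists_equiv_card_ne_le {α β : Type*} [Fintype α] [Fintype β] {r : ℕ}
    (e : α ≃ β) (q : α → Fin r) (p : β → Fin r) :
    ∃ f : α ≃ β, #{v | p (f v) ≠ q v} ≤ ∑ i, (#{y | p y = i} - #{v | q v = i}) := by
  -- The bijection with the fewest disagreements works: otherwise a transposition improves it.
  obtain ⟨f, -, hf⟩ := Finset.exists_min_image (univ : Finset (α ≃ β))
    (fun f => #{v | p (f v) ≠ q v}) ⟨e, mem_univ _⟩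
  refine ⟨f, ?_⟩
  have hfib : #{v | p (f v) ≠ q v} = ∑ i, #{v | p (f v) = i ∧ q v ≠ i} := by
    rw [Finset.card_eq_sum_card_fiberwise (f := fun v => p (f v)) (t := univ)
      (fun _ _ => mem_univ _)]
    refine Finset.sum_congr rfl fun i _ => congrArg _ ?_
    ext v
    simp only [mem_filter, mem_univ, true_and]
    constructor
    · rintro ⟨h1, rfl⟩
      exact ⟨rfl, h1.symm⟩
    · rintro ⟨rfl, h⟩
      exact ⟨h.symm, rfl⟩
  rw [hfib]
  refine Finset.sum_le_sum fun i _ => ?_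
  rcases Finset.eq_empty_or_nonempty {v | p (f v) = i ∧ q v ≠ i} with h | ⟨v, hv⟩
  · simp [h]
  simp only [mem_filter, mem_univ, true_and] at hv
  have hq : ∀ w, q w = i → p (f w) = i := by
    intro w hw
    by_contra hpw
    have hlt : #{u | p (((Equiv.swap v w).trans f) u) ≠ q u} < #{u | p (f u) ≠ q u} := by
      refine Finset.card_lt_card (Finset.ssubset_iff_of_subset ?_ |>.2 ⟨w, ?_, ?_⟩)
      · intro u hu
        replace hu := (Finset.mem_filter.1 hu).2
        rw [Equiv.trans_apply] at hu
        refine Finset.mem_filter.2 ⟨mem_univ _, ?_⟩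
        rcases eq_or_ne u v with rfl | huv
        · rw [hv.1]
          exact hv.2.symm
        rcases eq_or_ne u w with rfl | huw
        · rw [hw]
          exact hpw
        rwa [Equiv.swap_apply_of_ne_of_ne huv huw] at hu
      · simp [hw, hpw]
      · rw [Finset.mem_filter, Equiv.trans_apply, Equiv.swap_apply_right]
        simp [hw, hv.1]
    exact absurd (hf _ (mem_univ _)) (not_le.2 hlt)
  have hp : #{y | p y = i} = #{v | p (f v) = i} := by
    refine (Finset.card_bij (fun v _ => f v) ?_ ?_ ?_).symm
    · intro a ha
      simpa using ha
    · intro a _ b _ h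
      exact f.injective h
    · intro b hb
      exact ⟨f.symm b, by simpa using hb, by simp⟩
  rw [hp]
  refine Nat.le_sub_of_add_le ?_
  rw [← Finset.card_union_of_disjoint]
  · refine Finset.card_le_card fun u hu => ?_
    simp only [mem_union, mem_filter, mem_univ, true_and] at hu ⊢
    rcases hu with h | h
    · exact h.1
    · exact hq u h
  · rw [Finset.disjoint_left]
    intro u hu hu'
    simp only [mem_filter, mem_univ, true_and] at hu hu'
    exact hu.2 hu'

/-- The part of the Turán graph `turanGraph n r` that contains the vertex `v`. -/
def turanPart {r : ℕ} (hr : 0 < r) {n : ℕ} (v : Fin n) : Fin r := ⟨v % r, Nat.mod_lt _ hr⟩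

/-- The `j`-th vertex of the `i`-th part of the Turán graph `turanGraph n r`. -/
def turanVertex {r n : ℕ} (i : Fin r) (j : Fin (n / r)) : Fin n :=
  ⟨i + r * j, by
    have h1 : (j : ℕ) + 1 ≤ n / r := j.2
    have h2 := Nat.mul_le_mul_left r h1
    have h3 := Nat.mul_div_le n r
    have h4 := i.2
    rw [mul_add] at h2
    omega⟩

lemma turanVertex_mod {r n : ℕ} (i : Fin r) (j : Fin (n / r)) :
    (turanVertex i j : ℕ) % r = i := by
  simp [turanVertex, Nat.mod_eq_of_lt i.2]

lemma turanVertex_div {r n : ℕ} (i : Fin r) (j : Fin (n / r)) :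
    (turanVertex i j : ℕ) / r = j := by
  have hr : 0 < r := i.pos
  simp [turanVertex, Nat.add_mul_div_left _ _ hr, Nat.div_eq_of_lt i.2]

lemma div_le_card_turanPart {r : ℕ} (hr : 0 < r) (n : ℕ) (i : Fin r) :
    n / r ≤ #{v : Fin n | turanPart hr v = i} := by
  have h := Finset.card_le_card_of_injOn (s := (univ : Finset (Fin (n / r))))
    (t := {v : Fin n | turanPart hr v = i}) (fun j => turanVertex i j) ?_ ?_
  · simpa using h
  · intro j _
    exact Finset.mem_filter.2 ⟨mem_univ _, Fin.ext (turanVertex_mod i j)⟩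
  · intro a _ b _ hab
    have := congrArg (fun v : Fin n => (v : ℕ) / r) hab
    simp only [turanVertex_div] at this
    exact Fin.ext this

variable {V : Type v} [Fintype V] {G : SimpleGraph V}

lemma card_orderedCliques_two :
    #(orderedCliques G 2) = #({e | G.Adj e.1 e.2} : Finset (V × V)) := by
  refine Finset.card_bij' (fun f _ => (f 0, f 1)) (fun e _ => ![e.1, e.2]) ?_ ?_ ?_ ?_
  · intro f hf
    simpa using mem_orderedCliques.1 hf 0 1 (by decide)
  · rintro ⟨a, b⟩ h
    have h : G.Adj a b := by simpa using h
    refine mem_orderedCliques.2 fun i j hij => ?_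
    fin_cases i <;> fin_cases j <;> simp_all [h.symm]
  · intro f _
    ext i
    fin_cases i <;> rfl
  · intro e _
    rfl

/-- The edits that turn a relabelled Turán graph into `G` are accounted for by the edges inside the
classes of `p`, the missing edges between the classes, and the vertices whose class is not their
part of the Turán graph. -/
lemma ncard_symmDiff_le {r n : ℕ} (hr : 0 < r) (f : Fin n ≃ V) (p : V → Fin r) :
    (symmDiff ((SimpleGraph.turanGraph n r).map f).edgeSet G.edgeSet).ncard ≤
      #(innerPairs G p) + #({e | p e.1 ≠ p e.2 ∧ ¬ G.Adj e.1 e.2} : Finset (V × V)) +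
        2 * (#{v | p (f v) ≠ turanPart hr v} * Fintype.card V) := by
  set D : Finset V := ({v | p (f v) ≠ turanPart hr v} : Finset (Fin n)).map f.toEmbedding with hD
  have hmemD : ∀ y, y ∉ D → turanPart hr (f.symm y) = p y := by
    intro y hy
    by_contra hne
    refine hy (Finset.mem_map.2 ⟨f.symm y, ?_, by simp⟩)
    simpa using fun h => hne h.symm
  have hadj : ∀ a b, ((SimpleGraph.turanGraph n r).map f).Adj a b ↔
      turanPart hr (f.symm a) ≠ turanPart hr (f.symm b) := by
    intro a b
    change ((SimpleGraph.turanGraph n r).map f.toEmbedding).Adj a b ↔ _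
    rw [SimpleGraph.map_adj]
    simp only [SimpleGraph.turanGraph_adj, turanPart, Ne, Fin.mk.injEq]
    constructor
    · rintro ⟨u, w, h, rfl, rfl⟩
      simpa using h
    · intro h
      exact ⟨f.symm a, f.symm b, h, by simp, by simp⟩
  set X : Finset (V × V) := (innerPairs G p ∪
    ({e | p e.1 ≠ p e.2 ∧ ¬ G.Adj e.1 e.2} : Finset (V × V))) ∪ (D ×ˢ univ ∪ univ ×ˢ D) with hX
  have hsub : symmDiff ((SimpleGraph.turanGraph n r).map f).edgeSet G.edgeSet ⊆
      ((X.image fun e => s(e.1, e.2)) : Finset (Sym2 V)) := by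
    intro e
    induction e using Sym2.ind with
    | _ a b =>
    intro h
    rw [Finset.mem_coe, Finset.mem_image]
    refine ⟨(a, b), ?_, rfl⟩
    by_cases ha : a ∈ D
    · simp [hX, ha]
    by_cases hb : b ∈ D
    · simp [hX, hb]
    refine Finset.mem_union_left _ ?_
    rw [Set.mem_symmDiff, SimpleGraph.mem_edgeSet, SimpleGraph.mem_edgeSet, hadj, hmemD a ha,
      hmemD b hb] at h
    rw [Finset.mem_union]
    rcases h with h | h
    · exact Or.inr (by simpa using h)
    · refine Or.inl ?_
      simp only [innerPairs, mem_filter, mem_univ, true_and]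
      exact ⟨h.1, not_not.1 h.2⟩
  refine (Set.ncard_le_ncard hsub (Finset.finite_toSet _)).trans ?_
  rw [Set.ncard_coe_finset]
  refine Finset.card_image_le.trans <| (Finset.card_union_le _ _).trans <|
    add_le_add (Finset.card_union_le _ _) ((Finset.card_union_le _ _).trans ?_)
  simp only [Finset.card_product, Finset.card_univ, hD, Finset.card_map]
  exact le_of_eq (by ring)

lemma sum_card_sq_add_card_ne {r : ℕ} (p : V → Fin r) :
    ∑ i, #{y | p y = i} ^ 2 + #({e | p e.1 ≠ p e.2} : Finset (V × V)) = Fintype.card V ^ 2 := by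
  have h1 : ∑ i, #{y | p y = i} ^ 2 = #({e | p e.1 = p e.2} : Finset (V × V)) := by
    rw [Finset.card_eq_sum_card_fiberwise (f := fun e : V × V => p e.1) (t := univ)
      (fun _ _ => mem_univ _)]
    refine Finset.sum_congr rfl fun i _ => ?_
    rw [sq, ← Finset.card_product]
    congr 1
    ext ⟨a, b⟩
    simp only [mem_product, mem_filter, mem_univ, true_and]
    constructor
    · rintro ⟨rfl, h⟩
      exact ⟨h.symm, rfl⟩
    · rintro ⟨h, rfl⟩
      exact ⟨rfl, h.symm⟩
  rw [h1, Finset.card_filter_add_card_filter_not, sq]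
  simp

/-- A graph that is almost `r`-partite and almost as dense as the Turán graph is close to it. -/
lemma obtainableByEdits_of_partition {r n : ℕ} (hr : 0 < r) (hn : Fintype.card V = n) {η θ : ℝ}
    (hθ : 0 ≤ θ) (hηθ : 2 * η * r ≤ θ ^ 2) (p : V → Fin r)
    (hp : (#(innerPairs G p) : ℝ) ≤ η * (n : ℝ) ^ 2)
    (hG : (1 - 1 / r - η) * (n : ℝ) ^ 2 ≤ #(orderedCliques G 2)) :
    ObtainableByEdits (SimpleGraph.turanGraph n r) G
      ((3 * η + 2 * θ) * (n : ℝ) ^ 2 + 2 * r * n) := by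
  have hr' : (0 : ℝ) < r := by positivity
  obtain ⟨f, hf⟩ := exists_equiv_card_ne_le (Fintype.equivFinOfCardEq hn).symm (turanPart hr) p
  refine ⟨f, Set.toFinite _, ?_⟩
  have hncard := ncard_symmDiff_le (G := G) hr f p
  set a : Fin r → ℝ := fun i => (#{y | p y = i} : ℝ) with ha
  have hsum : ∑ i, a i = n := by
    have := Finset.card_eq_sum_card_fiberwise (s := (univ : Finset V)) (f := p) (t := univ)
      (fun _ _ => mem_univ _)
    rw [Finset.card_univ, hn] at this
    rw [this]
    push_cast
    rfl
  -- The pairs between classes are adjacent or missing; the adjacent pairs are nearly all of `G`.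
  set M := #({e | p e.1 ≠ p e.2 ∧ ¬ G.Adj e.1 e.2} : Finset (V × V)) with hM
  have hsplit : #({e | p e.1 ≠ p e.2} : Finset (V × V)) + #(innerPairs G p) =
      #(orderedCliques G 2) + M := by
    rw [card_orderedCliques_two, ← Finset.card_filter_add_card_filter_not
      (s := ({e | G.Adj e.1 e.2} : Finset (V × V))) (fun e => p e.1 = p e.2),
      ← Finset.card_filter_add_card_filter_not
      (s := ({e | p e.1 ≠ p e.2} : Finset (V × V))) (fun e => G.Adj e.1 e.2)]
    simp only [Finset.filter_filter, innerPairs, hM, and_comm (a := G.Adj _ _), Ne]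
    omega
  have hsq := sum_card_sq_add_card_ne p
  rw [hn] at hsq
  have hsplit' : (#({e | p e.1 ≠ p e.2} : Finset (V × V)) : ℝ) + #(innerPairs G p) =
      #(orderedCliques G 2) + M := by exact_mod_cast hsplit
  have hsq' : ∑ i, a i ^ 2 + (#({e | p e.1 ≠ p e.2} : Finset (V × V)) : ℝ) = (n : ℝ) ^ 2 := by
    have := congrArg (Nat.cast (R := ℝ)) hsq
    push_cast at this
    exact this
  have hdev : ∑ i, (a i - n / r) ^ 2 = ∑ i, a i ^ 2 - (n : ℝ) ^ 2 / r := by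
    simp only [sub_sq, Finset.sum_add_distrib, Finset.sum_sub_distrib, ← Finset.sum_mul,
      ← Finset.mul_sum, hsum]
    simp only [Finset.sum_const, Finset.card_univ, Fintype.card_fin, nsmul_eq_mul]
    field_simp
    ring
  have hdev0 : 0 ≤ ∑ i, (a i - n / r) ^ 2 := Finset.sum_nonneg fun i _ => sq_nonneg _
  have hexp : (1 - 1 / r - η) * (n : ℝ) ^ 2 = (n : ℝ) ^ 2 - (n : ℝ) ^ 2 / r - η * (n : ℝ) ^ 2 := by
    ring
  have hM2 : (M : ℝ) ≤ 2 * η * (n : ℝ) ^ 2 := by linarith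
  have hdev2 : ∑ i, (a i - n / r) ^ 2 ≤ 2 * η * (n : ℝ) ^ 2 := by
    have : (0 : ℝ) ≤ M := by positivity
    linarith
  have habs : ∑ i, |a i - n / r| ≤ θ * n := by
    refine le_of_sq_le_sq ?_ (by positivity)
    have h1 := sq_sum_le_card_mul_sum_sq (s := (univ : Finset (Fin r)))
      (f := fun i => |a i - n / r|)
    simp only [sq_abs, Finset.card_univ, Fintype.card_fin] at h1
    calc _ ≤ (r : ℝ) * ∑ i, (a i - n / r) ^ 2 := h1
      _ ≤ r * (2 * η * (n : ℝ) ^ 2) := by gcongr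
      _ = (2 * η * r) * (n : ℝ) ^ 2 := by ring
      _ ≤ θ ^ 2 * (n : ℝ) ^ 2 := by gcongr
      _ = (θ * n) ^ 2 := by ring
  have hD : (#{v | p (f v) ≠ turanPart hr v} : ℝ) ≤ θ * n + r := by
    calc (#{v | p (f v) ≠ turanPart hr v} : ℝ)
        ≤ (∑ i, (#{y | p y = i} - #{v : Fin n | turanPart hr v = i}) : ℕ) := by
          exact_mod_cast hf
      _ ≤ ∑ i, (|a i - n / r| + 1) := by
          push_cast
          refine Finset.sum_le_sum fun i _ => ?_
          rcases le_total #{y | p y = i} #{v : Fin n | turanPart hr v = i} with h | h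
          · rw [Nat.sub_eq_zero_of_le h]
            push_cast
            positivity
          · rw [Nat.cast_sub h]
            have h1 : ((n / r : ℕ) : ℝ) ≤ #{v : Fin n | turanPart hr v = i} := by
              exact_mod_cast div_le_card_turanPart hr n i
            have h2 : (n : ℝ) / r < (n / r : ℕ) + 1 := by
              rw [div_lt_iff₀ hr']
              exact_mod_cast Nat.lt_mul_of_div_lt (Nat.lt_succ_self _) hr
            have h3 := le_abs_self (a i - n / r)
            simp only [ha] at h3 ⊢
            linarith
      _ = ∑ i, |a i - n / r| + r := by simp [Finset.sum_add_distrib]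
      _ ≤ θ * n + r := by linarith
  have hncard' : ((symmDiff ((SimpleGraph.turanGraph n r).map f).edgeSet G.edgeSet).ncard : ℝ) ≤
      #(innerPairs G p) + M + 2 * (#{v | p (f v) ≠ turanPart hr v} * n) := by
    rw [hn] at hncard
    exact_mod_cast hncard
  have hDn := mul_le_mul_of_nonneg_right hD (Nat.cast_nonneg (α := ℝ) n)
  refine hncard'.trans ?_
  linear_combination hp + hM2 + 2 * hDn

end Edits

/-! ### Graphs that do not contain a fixed graph have few large cliques -/

section BoxRelations

open Finset
open scoped Classical

lemma card_not_injective_le (V : Type v) [Fintype V] (t : ℕ) :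
    #({T | ¬ Function.Injective T} : Finset (Fin (t + 1) → V)) ≤
      (t + 1) ^ 2 * Fintype.card V ^ t := by
  have hsub : ({T | ¬ Function.Injective T} : Finset (Fin (t + 1) → V)) ⊆
      ((univ : Finset (Fin (t + 1) × Fin (t + 1))).filter fun e => e.1 ≠ e.2).biUnion
        fun e => {T | T e.1 = T e.2} := by
    intro T hT
    replace hT := (Finset.mem_filter.1 hT).2
    simp only [Function.Injective] at hT
    push Not at hT
    obtain ⟨i, j, h, hij⟩ := hT
    exact Finset.mem_biUnion.2 ⟨(i, j), by simpa using hij, by simpa using h⟩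
  refine (Finset.card_le_card hsub).trans <| (Finset.card_biUnion_le_card_mul _ _
    (Fintype.card V ^ t) ?_).trans ?_
  · rintro ⟨i, j⟩ hij
    have hij : i ≠ j := by simpa using hij
    have h := Finset.card_le_card_of_injOn (s := ({T | T i = T j} : Finset (Fin (t + 1) → V)))
      (t := (univ : Finset (Fin t → V))) (fun T => i.removeNth T) (fun _ _ => mem_univ _) ?_
    · simpa using h
    · intro T hT T' hT' hTT
      have hT : T i = T j := by simpa using hT
      have hT' : T' i = T' j := by simpa using hT'
      obtain ⟨a, rfl⟩ := Fin.exists_succAbove_eq hij.symm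
      have h1 : ∀ b, T (i.succAbove b) = T' (i.succAbove b) := fun b => congrFun hTT b
      funext b
      rcases Fin.eq_self_or_eq_succAbove i b with rfl | ⟨b, rfl⟩
      · rw [hT, hT', h1]
      · exact h1 b
  · refine Nat.mul_le_mul_right _ ((Finset.card_filter_le _ _).trans ?_)
    simp [sq]

/-- Double counting of the pairs of a `k`-tuple and `t + 1` ways to extend it to an element of `S`,
together with the power mean inequality. -/
lemma card_pow_le_mul_sum_card {V : Type v} [Fintype V] {k : ℕ} (t : ℕ)
    (S : Finset (Fin (k + 1) → V)) :
    (#S : ℝ) ^ (t + 1) ≤ ((Fintype.card V : ℝ) ^ k) ^ t * ∑ T : Fin (t + 1) → V,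
      (#{g : Fin k → V | ∀ j, (Fin.cons (T j) g : Fin (k + 1) → V) ∈ S} : ℝ) := by
  set d : (Fin k → V) → Finset V := fun g => {y | (Fin.cons y g : Fin (k + 1) → V) ∈ S} with hd
  have h1 : #S = ∑ g, #(d g) := by
    rw [← Finset.card_sigma]
    refine Finset.card_bij' (fun f _ => ⟨Fin.tail f, f 0⟩) (fun x _ => Fin.cons x.2 x.1) ?_ ?_ ?_ ?_
    · intro f hf
      simpa [hd] using hf
    · rintro ⟨g, y⟩ h
      simpa [hd] using h
    · intro f _
      simp
    · intro x _
      simp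
  have h2 : ∑ g, #(d g) ^ (t + 1) = ∑ T : Fin (t + 1) → V,
      #{g : Fin k → V | ∀ j, (Fin.cons (T j) g : Fin (k + 1) → V) ∈ S} := by
    have h3 : ∀ g, #(d g) ^ (t + 1) =
        #{T : Fin (t + 1) → V | ∀ j, (Fin.cons (T j) g : Fin (k + 1) → V) ∈ S} := by
      intro g
      have := Fintype.card_piFinset_const (d g) (t + 1)
      rw [← this]
      congr 1
      ext T
      simp [hd]
    simp only [h3, Finset.card_filter]
    exact Finset.sum_comm
  have h4 := pow_sum_le_card_mul_sum_pow (s := (univ : Finset (Fin k → V)))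
    (f := fun g => (#(d g) : ℝ)) (fun _ _ => Nat.cast_nonneg _) t
  have h5 : (#(univ : Finset (Fin k → V)) : ℝ) = (Fintype.card V : ℝ) ^ k := by simp
  have h6 := congrArg (Nat.cast (R := ℝ)) h2
  push_cast at h6
  rwa [h5, h6, ← Nat.cast_sum, ← h1] at h4

/-- Erdős's theorem on complete multipartite hypergraphs: a dense `k`-ary relation on a large set
contains a box, all of whose sides have size `t + 1`. -/
lemma exists_box (t k : ℕ) : ∀ {γ : ℝ}, 0 < γ → ∃ n₀ : ℕ, ∀ (V : Type v) [Fintype V],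
    n₀ ≤ Fintype.card V → ∀ S : Finset (Fin k → V), γ * (Fintype.card V : ℝ) ^ k ≤ #S →
      ∃ a : Fin k → Fin (t + 1) → V, (∀ i, Function.Injective (a i)) ∧
        ∀ c : Fin k → Fin (t + 1), (fun i => a i (c i)) ∈ S := by
  induction k with
  | zero =>
    intro γ hγ
    refine ⟨0, fun V _ _ S hS => ⟨fun i => i.elim0, fun i => i.elim0, fun c => ?_⟩⟩
    have : (0 : ℝ) < #S := lt_of_lt_of_le (by simpa using hγ) hS
    obtain ⟨f, hf⟩ := Finset.card_pos.1 (by exact_mod_cast this)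
    rwa [Subsingleton.elim (fun i : Fin 0 => (i.elim0 : Fin (t + 1) → V) (c i)) f]
  | succ k ih =>
    intro γ hγ
    have hγ' : 0 < γ ^ (t + 1) / 2 := by positivity
    obtain ⟨n₁, hn₁⟩ := ih hγ'
    obtain ⟨n₂, hn₂⟩ := exists_nat_gt (((t : ℝ) + 1) ^ 2 / (γ ^ (t + 1) / 2))
    refine ⟨max n₁ n₂, fun V _ hV S hS => ?_⟩
    set N : ℝ := (Fintype.card V : ℝ) with hN
    have hn₂N : (n₂ : ℝ) ≤ N := by
      rw [hN]
      exact_mod_cast (le_max_right _ _).trans hV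
    have hN0 : 0 < N := lt_of_lt_of_le (lt_of_le_of_lt (by positivity) hn₂) hn₂N
    have hbig : ((t : ℝ) + 1) ^ 2 < γ ^ (t + 1) / 2 * N := by
      rw [div_lt_iff₀ hγ'] at hn₂
      nlinarith
    set slice : (Fin (t + 1) → V) → Finset (Fin k → V) := fun T =>
      {g | ∀ j, (Fin.cons (T j) g : Fin (k + 1) → V) ∈ S} with hslice
    -- Otherwise all injective tuples would have small slices, and the others are few.
    obtain ⟨T, hT, hTS⟩ : ∃ T : Fin (t + 1) → V, Function.Injective T ∧
        γ ^ (t + 1) / 2 * N ^ k ≤ #(slice T) := by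
      by_contra! hcon
      have hupper : ∑ T, (#(slice T) : ℝ) ≤
          N ^ (t + 1) * (γ ^ (t + 1) / 2 * N ^ k) + ((t + 1) ^ 2 * N ^ t) * N ^ k := by
        rw [← Finset.sum_filter_add_sum_filter_not univ (fun T => Function.Injective T)]
        refine add_le_add ?_ ?_
        · refine (Finset.sum_le_card_nsmul _ _ _ fun T hT =>
            (hcon T (Finset.mem_filter.1 hT).2).le).trans ?_
          rw [nsmul_eq_mul]
          gcongr
          calc _ ≤ ((Fintype.card (Fin (t + 1) → V) : ℕ) : ℝ) := by
                exact_mod_cast Finset.card_le_univ _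
            _ = N ^ (t + 1) := by simp [hN]
        · refine (Finset.sum_le_card_nsmul _ _ (N ^ k) fun T hT => ?_).trans ?_
          · calc _ ≤ ((Fintype.card (Fin k → V) : ℕ) : ℝ) := by
                  exact_mod_cast Finset.card_le_univ _
              _ = N ^ k := by simp [hN]
          · rw [nsmul_eq_mul]
            gcongr
            rw [hN]
            exact_mod_cast card_not_injective_le V t
      have hlower : γ ^ (t + 1) * N ^ (k + t + 1) ≤ ∑ T, (#(slice T) : ℝ) := by
        have h1 := card_pow_le_mul_sum_card t S
        have h2 : (γ * N ^ (k + 1)) ^ (t + 1) ≤ (#S : ℝ) ^ (t + 1) := by gcongr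
        have h3 : 0 < (N ^ k) ^ t := by positivity
        refine le_of_mul_le_mul_left (le_trans (le_of_eq ?_) (h2.trans h1)) h3
        ring
      have h5 := mul_lt_mul_of_pos_right hbig (by positivity : 0 < N ^ t * N ^ k)
      have h6 := hlower.trans hupper
      have e1 : γ ^ (t + 1) * N ^ (k + t + 1) = 2 * (γ ^ (t + 1) / 2 * N * (N ^ t * N ^ k)) := by
        ring
      have e2 : N ^ (t + 1) * (γ ^ (t + 1) / 2 * N ^ k) + ((t + 1) ^ 2 * N ^ t) * N ^ k =
          γ ^ (t + 1) / 2 * N * (N ^ t * N ^ k) + ((t : ℝ) + 1) ^ 2 * (N ^ t * N ^ k) := by ring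
      linarith
    obtain ⟨a, ha, haS⟩ := hn₁ V ((le_max_left _ _).trans hV) (slice T) hTS
    refine ⟨Fin.cons T a, fun i => ?_, fun c => ?_⟩
    · refine Fin.cases ?_ (fun i => ?_) i
      · simpa using hT
      · simpa using ha i
    · have h := haS (fun i => c i.succ)
      simp only [hslice, mem_filter, mem_univ, true_and] at h
      have h' := h (c 0)
      convert h' using 1
      funext i
      refine Fin.cases ?_ (fun i => ?_) i <;> simp

/-- A graph that does not contain a given `k`-colourable graph has few ordered `k`-cliques. -/
lemma exists_cliqueDensity_le_of_free {W : Type u} [Finite W] {H : SimpleGraph W} {k : ℕ}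
    (hH : H.Colorable k) {γ : ℝ} (hγ : 0 < γ) : ∃ n₀ : ℕ, ∀ (V : Type v) [Fintype V],
      n₀ ≤ Fintype.card V → ∀ G : SimpleGraph V, H.Free G → cliqueDensity G k ≤ γ := by
  obtain ⟨t, ⟨e⟩⟩ := Finite.exists_equiv_fin W
  obtain ⟨C⟩ := hH
  obtain ⟨n₀, hn₀⟩ := exists_box.{v} t k hγ
  refine ⟨max n₀ 1, fun V _ hV G hG => ?_⟩
  by_contra! hcon
  have hpos : (0 : ℝ) < Fintype.card V := by
    exact_mod_cast lt_of_lt_of_le Nat.one_pos ((le_max_right _ _).trans hV)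
  obtain ⟨a, ha, haS⟩ := hn₀ V ((le_max_left _ _).trans hV) (orderedCliques G k) (by
    unfold cliqueDensity at hcon
    rw [lt_div_iff₀ (by positivity)] at hcon
    exact hcon.le)
  have hadj : ∀ i j, i ≠ j → ∀ x y, G.Adj (a i x) (a j y) := by
    intro i j hij x y
    have := mem_orderedCliques.1 (haS (Function.update (fun _ => x) j y)) i j hij
    simpa [Function.update_of_ne hij] using this
  refine hG ⟨⟨⟨fun w => a (C w) (e w).castSucc, fun {x y} h => hadj _ _ (C.valid h) _ _⟩, ?_⟩⟩
  intro x y hxy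
  change a (C x) (e x).castSucc = a (C y) (e y).castSucc at hxy
  by_cases hc : C x = C y
  · rw [hc] at hxy
    exact e.injective (Fin.castSucc_injective _ (ha _ hxy))
  · have := hadj _ _ hc (e x).castSucc (e y).castSucc
    rw [hxy] at this
    exact absurd this (G.irrefl)

end BoxRelations

/-! ### Counting unlabelled cliques, and the Turán graph -/

section CountingCliques

open Finset Filter Topology
open scoped Classical

variable {V : Type v} {G : SimpleGraph V}

/-- Two copies of a complete graph have the same image subgraph as soon as they have the same
vertices. -/
lemma toSubgraph_eq_iff_range_eq {m : ℕ}
    (f g : SimpleGraph.Copy (SimpleGraph.completeGraph (Fin m)) G) :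
    f.toSubgraph = g.toSubgraph ↔ Set.range f = Set.range g := by
  have hv : ∀ f : SimpleGraph.Copy (SimpleGraph.completeGraph (Fin m)) G,
      f.toSubgraph.verts = Set.range f := fun f => by
    simp [SimpleGraph.Copy.toSubgraph]
  have ha : ∀ (f : SimpleGraph.Copy (SimpleGraph.completeGraph (Fin m)) G) (x y : V),
      f.toSubgraph.Adj x y ↔ x ∈ Set.range f ∧ y ∈ Set.range f ∧ x ≠ y := by
    intro f x y
    simp only [SimpleGraph.Copy.toSubgraph, SimpleGraph.Subgraph.map_adj,
      SimpleGraph.Subgraph.top_adj, Relation.Map]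
    constructor
    · rintro ⟨a, b, h, rfl, rfl⟩
      exact ⟨⟨a, rfl⟩, ⟨b, rfl⟩, fun hab => h.ne (f.injective hab)⟩
    · rintro ⟨⟨a, rfl⟩, ⟨b, rfl⟩, h⟩
      exact ⟨a, b, fun hab => h (by rw [hab]), rfl, rfl⟩
  constructor
  · intro h
    rw [← hv, ← hv, h]
  · intro h
    refine SimpleGraph.Subgraph.ext (by rw [hv, hv, h]) ?_
    funext x y
    rw [eq_iff_iff, ha, ha, h]

variable [Fintype V]

/-- The copies of a complete graph with a given image are the reorderings of one of them. -/
lemma card_filter_range_eq {m : ℕ}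
    (f : SimpleGraph.Copy (SimpleGraph.completeGraph (Fin m)) G) :
    #{g : SimpleGraph.Copy (SimpleGraph.completeGraph (Fin m)) G | Set.range g = Set.range f} =
      m.factorial := by
  have hcard : #(univ : Finset (Equiv.Perm (Fin m))) = m.factorial := by
    rw [Finset.card_univ, Fintype.card_perm, Fintype.card_fin]
  rw [← hcard]
  symm
  refine Finset.card_bij (fun σ _ => f.comp
    (SimpleGraph.Iso.completeGraph σ).toCopy) ?_ ?_ ?_
  · intro σ _
    refine Finset.mem_filter.2 ⟨mem_univ _, ?_⟩
    exact σ.surjective.range_comp f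
  · intro σ _ τ _ h
    ext i
    exact congrArg Fin.val (f.injective (DFunLike.congr_fun h i))
  · intro g hg
    replace hg := (Finset.mem_filter.1 hg).2
    have h : ∀ i, ∃ j, f j = g i := fun i => by
      have : g i ∈ Set.range f := hg ▸ Set.mem_range_self i
      exact this
    choose σ hσ using h
    have hinj : Function.Injective σ := fun a b hab => g.injective <|
      (hσ a).symm.trans ((congrArg f hab).trans (hσ b))
    refine ⟨Equiv.ofBijective σ (Finite.injective_iff_bijective.1 hinj), mem_univ _, ?_⟩
    exact DFunLike.ext _ _ hσ

lemma numCliques_mul_factorial (m : ℕ) :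
    numCliques G m * m.factorial = #(orderedCliques G m) := by
  have h1 : #(orderedCliques G m) =
      #(univ : Finset (SimpleGraph.Copy (SimpleGraph.completeGraph (Fin m)) G)) := by
    symm
    refine Finset.card_bij (fun f _ => f) ?_ ?_ ?_
    · intro f _
      exact mem_orderedCliques.2 fun i j hij => f.toHom.map_adj hij
    · intro f _ g _ h
      exact DFunLike.coe_injective h
    · intro f hf
      have hadj := mem_orderedCliques.1 hf
      refine ⟨⟨⟨f, fun {a b} h => hadj a b h.ne⟩, fun a b hab => ?_⟩, mem_univ _, rfl⟩
      by_contra hne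
      have h := hadj a b hne
      exact h.ne hab
  rw [h1, numCliques, SimpleGraph.copyCount_eq_card_image_copyToSubgraph,
    Finset.card_eq_sum_card_image SimpleGraph.Copy.toSubgraph univ]
  symm
  refine Finset.sum_const_nat fun G' hG' => ?_
  obtain ⟨f, -, rfl⟩ := Finset.mem_image.1 hG'
  simp only [toSubgraph_eq_iff_range_eq]
  exact card_filter_range_eq f

/-- Choose distinct parts, and in each of them one of the first `n / r` vertices. -/
lemma descFactorial_mul_le_card_orderedCliques_turanGraph (n r m : ℕ) :
    r.descFactorial m * (n / r) ^ m ≤ #(orderedCliques (SimpleGraph.turanGraph n r) m) := by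
  have h := Finset.card_le_card_of_injOn
    (s := (univ : Finset ((Fin m ↪ Fin r) × (Fin m → Fin (n / r)))))
    (t := orderedCliques (SimpleGraph.turanGraph n r) m)
    (fun x i => turanVertex (x.1 i) (x.2 i)) ?_ ?_
  · simpa [Fintype.card_embedding_eq] using h
  · rintro ⟨c, j⟩ _
    refine mem_orderedCliques.2 fun a b hab => ?_
    rw [SimpleGraph.turanGraph_adj, turanVertex_mod, turanVertex_mod]
    exact fun h => hab (c.injective (Fin.ext h))
  · rintro ⟨c, j⟩ _ ⟨c', j'⟩ _ h
    have h1 : ∀ i, c i = c' i := fun i => by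
      have := congrArg (fun v : Fin n => (v : ℕ) % r) (congrFun h i)
      simp only [turanVertex_mod] at this
      exact Fin.ext this
    have h2 : ∀ i, j i = j' i := fun i => by
      have := congrArg (fun v : Fin n => (v : ℕ) / r) (congrFun h i)
      simp only [turanVertex_div] at this
      exact Fin.ext this
    exact Prod.ext (DFunLike.ext _ _ h1) (funext h2)

/-- The Turán graphs attain the densities `turanCliqueDensity r` in the limit. -/
lemma eventually_le_card_orderedCliques_turanGraph (r : ℕ) {η : ℝ} (hη : 0 < η) :
    ∀ᶠ n : ℕ in atTop, ∀ m ≤ r, (turanCliqueDensity r m - η) * (n : ℝ) ^ m ≤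
      #(orderedCliques (SimpleGraph.turanGraph n r) m) := by
  have h1 : Tendsto (fun n : ℕ => ((n / r : ℕ) : ℝ) / n) atTop (𝓝 (1 / r)) := by
    have := (tendsto_nat_floor_mul_div_atTop (R := ℝ) (a := 1 / r) (by positivity)).comp
      (tendsto_natCast_atTop_atTop (R := ℝ))
    refine this.congr fun n => ?_
    rw [Function.comp_apply, one_div_mul_eq_div, Nat.floor_div_eq_div]
  have h2 : ∀ m ∈ Finset.range (r + 1), ∀ᶠ n : ℕ in atTop,
      (turanCliqueDensity r m - η) * (n : ℝ) ^ m ≤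
        #(orderedCliques (SimpleGraph.turanGraph n r) m) := by
    intro m _
    have h3 : Tendsto (fun n : ℕ => (r.descFactorial m : ℝ) * (((n / r : ℕ) : ℝ) / n) ^ m) atTop
        (𝓝 (turanCliqueDensity r m)) := by
      have := (h1.pow m).const_mul (r.descFactorial m : ℝ)
      convert this using 2
      rw [turanCliqueDensity, one_div, inv_pow, div_eq_mul_inv]
    filter_upwards [h3.eventually_const_le (sub_lt_self _ hη), eventually_gt_atTop 0] with n hn hn0
    have hn0' : (0 : ℝ) < n := by exact_mod_cast hn0
    calc (turanCliqueDensity r m - η) * (n : ℝ) ^ m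
        ≤ ((r.descFactorial m : ℝ) * (((n / r : ℕ) : ℝ) / n) ^ m) * (n : ℝ) ^ m := by gcongr
      _ = ((r.descFactorial m * (n / r) ^ m : ℕ) : ℝ) := by
          push_cast
          rw [div_pow]
          field_simp
      _ ≤ _ := by exact_mod_cast descFactorial_mul_le_card_orderedCliques_turanGraph n r m
  filter_upwards [(Filter.eventually_all_finset (Finset.range (r + 1))).2 h2] with n hn m hm
  exact hn m (by simpa [Nat.lt_succ_iff] using hm)

end CountingCliques

/-! ### Stability -/

theorem theorem1p4 {W : Type u} [Finite W] (H : SimpleGraph W) (r : ℕ)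
    (hH : H.chromaticNumber = ((r + 1 : ℕ) : ℕ∞)) (ε : ℝ) (hε : 0 < ε) :
    ∃ δ : ℝ, 0 < δ ∧ ∃ n₀ : ℕ, ∀ m : ℕ, 2 ≤ m → m ≤ r →
      ∀ (V : Type v) [Fintype V] (n : ℕ), Fintype.card V = n → n₀ ≤ n →
        ∀ G : SimpleGraph V, H.Free G →
          (numCliques (SimpleGraph.turanGraph n r) m : ℝ) - δ * (n : ℝ) ^ m
              ≤ (numCliques G m : ℝ) →
            ObtainableByEdits (SimpleGraph.turanGraph n r) G (ε * (n : ℝ) ^ 2) := by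
  rcases lt_or_ge r 2 with hr | hr
  · exact ⟨1, one_pos, 0, fun m h2 hm => by omega⟩
  have hr' : (0 : ℝ) < r := by positivity
  have hcol : H.Colorable (r + 1) :=
    SimpleGraph.chromaticNumber_le_iff_colorable.1 hH.le
  -- The edit bound below is `(3 η + 2 θ) n² + 2 r n`; both summands are to be at most `ε n² / 2`.
  obtain ⟨θ, hθ⟩ : ∃ θ, θ = ε / 8 := ⟨_, rfl⟩
  have hθ0 : 0 < θ := by linarith
  obtain ⟨η, hη⟩ : ∃ η, η = min (ε / 16) (θ ^ 2 / (2 * r)) := ⟨_, rfl⟩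
  have hη0 : 0 < η := by rw [hη]; positivity
  have hη1 : η ≤ ε / 16 := hη ▸ min_le_left _ _
  have hη2 : 2 * η * r ≤ θ ^ 2 := by
    have := hη ▸ min_le_right (ε / 16) (θ ^ 2 / (2 * r))
    rw [le_div_iff₀ (by positivity)] at this
    linarith
  obtain ⟨γ, hγ, hstab⟩ := exists_forall_moonMoserSeqs_mem r
    (eventually_exists_partition.{v} hr hη0)
  obtain ⟨n₁, hn₁⟩ := exists_cliqueDensity_le_of_free.{u, v} hcol hγ
  obtain ⟨n₂, hn₂⟩ := Filter.eventually_atTop.1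
    (eventually_le_card_orderedCliques_turanGraph r (half_pos hγ))
  obtain ⟨n₃, hn₃⟩ := exists_nat_gt (4 * r / ε)
  -- Dividing by `r!` turns a loss of unlabelled cliques into a loss of ordered ones, for all `m ≤ r`.
  have hfac : (0 : ℝ) < r.factorial := by positivity
  refine ⟨γ / 2 / r.factorial, by positivity, max (max n₁ n₂) (max n₃ 1), ?_⟩
  intro m hm2 hmr V _ n hn hle G hG hcount
  simp only [max_le_iff] at hle
  obtain ⟨⟨hle1, hle2⟩, hle3, hle4⟩ := hle
  have hn0 : (0 : ℝ) < n := by exact_mod_cast hle4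
  have : Nonempty V := Fintype.card_pos_iff.1 (by omega)
  have hdens : turanCliqueDensity r m - γ ≤ cliqueDensity G m := by
    have h1 := hn₂ n hle2 m hmr
    have hm0 : (0 : ℝ) < m.factorial := by positivity
    have h2 := mul_le_mul_of_nonneg_right hcount hm0.le
    rw [sub_mul] at h2
    have e1 : (numCliques (SimpleGraph.turanGraph n r) m : ℝ) * m.factorial =
        (orderedCliques (SimpleGraph.turanGraph n r) m).card := by
      exact_mod_cast numCliques_mul_factorial m
    have e2 : (numCliques G m : ℝ) * m.factorial = (orderedCliques G m).card := by
      exact_mod_cast numCliques_mul_factorial m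
    have h3 : γ / 2 / r.factorial * (n : ℝ) ^ m * m.factorial ≤ γ / 2 * (n : ℝ) ^ m := by
      have h4 : (m.factorial : ℝ) ≤ r.factorial := by exact_mod_cast Nat.factorial_le hmr
      calc γ / 2 / r.factorial * (n : ℝ) ^ m * m.factorial
          ≤ γ / 2 / r.factorial * (n : ℝ) ^ m * r.factorial := by gcongr
        _ = γ / 2 * (n : ℝ) ^ m := by field_simp
    rw [e1, e2] at h2
    rw [cliqueDensity, hn, le_div_iff₀ (by positivity)]
    linarith
  obtain ⟨hedge, p, hp⟩ := hstab m hm2 hmr (cliqueDensity G) cliqueDensity_mem_moonMoserSeqs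
    (hn₁ V (by omega) G hG) hdens V G rfl
  have hG2 := mul_le_mul_of_nonneg_right hedge (sq_nonneg (n : ℝ))
  have h2 := card_orderedCliques_eq (G := G) 2
  rw [hn] at h2 hp
  obtain ⟨f, hfin, hf⟩ := obtainableByEdits_of_partition (by omega) hn hθ0.le hη2 p hp
    (hG2.trans h2.ge)
  refine ⟨f, hfin, hf.trans ?_⟩
  have h4 : 4 * (r : ℝ) ≤ ε * n := by
    rw [div_lt_iff₀ hε] at hn₃
    have : (n₃ : ℝ) ≤ n := by exact_mod_cast hle3
    nlinarith
  have h5 := mul_le_mul_of_nonneg_right h4 hn0.le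
  have h6 : (3 * η + 2 * θ) * (n : ℝ) ^ 2 ≤ ε / 2 * (n : ℝ) ^ 2 := by
    gcongr
    linarith
  linear_combination h6 + h5 / 2
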